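/- Let $K=\mathbb{C}(X_1,X_2,X_3,\dots)$ be the field of rational functions over $\mathbb C$ in countably infinitely many indeterminates. Let $G=\bigoplus_{n\ge 1}\mathbb{Z}$ with the lexicographic order ($g<h$ iff $g_i<h_i$ at the first index $i$ at which $g$ and $h$ differ), and let $e_i$ be its $i$-th standard basis vector, so that $e_1>e_2>e_3>\cdots$. Let $v$ be the unique valuation on $K$, trivial on $\mathbb{C}^\times$, with value group $G$ and $v(X_i)=e_i$ for all $i$. Let $V$ be its valuation ring, $\mathfrak m$ the maximal ideal of $V$ and $\kappa=V/\mathfrak m$. For a closed subset $Z$ of a topological space $X$, let $H^i\Gamma_Z$ be the $i$-th right derived functor of the functor $\Gamma_Z(\mathcal F)=\ker\big(\mathcal F(X)\to\mathcal F(X\setminus Z)\big)$ from sheaves of abelian groups on $X$ to abelian groups. For an ideal $I$ of a commutative ring $A$, let $R^i\Gamma_I$ be the $i$-th right derived functor of the $I$-torsion functor $\Gamma_I(M)=\{x\in M : I^nx=0 \text{ for some } n\ge 1\}$ on $A$-modules. Then: 1. $V$ has infinite Krull dimension. 2. $\mathfrak m$ is not finitely generated, and $\mathfrak m=(X_1,X_2,X_3,\dots)$.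 3. The punctured spectrum $\operatorname{Spec}(V)\setminus\{\mathfrak m\}$ is not quasi-compact, hence not affine. 4. If $Z=\{\mathfrak m\}$ is the closed point of $\operatorname{Spec}(V)$, then $H^2\Gamma_Z(\mathcal O_{\operatorname{Spec}(V)})\neq 0$. 5. As a $V$-module, $\kappa$ has projective dimension $2$. 6. For every $V$-module $M$ and all $i\ge 3$, $R^i\Gamma_{\mathfrak m}(M)=0$. -/

import Mathlib

open CategoryTheory CategoryTheory.Limits TopologicalSpace AlgebraicGeometry

/-! ### The field `K`, the ordered group `G` and the valuation `v` -/

/-- The field `ℂ(X₁, X₂, X₃, …)` of rational functions in countably many indeterminates.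
The indeterminates are indexed by `ℕ = {0, 1, 2, …}`, so `X₁` has index `0`, `X₂` index `1`, … -/
abbrev RatField : Type := FractionRing (MvPolynomial ℕ ℂ)

/-- The indeterminate of index `i`, as an element of the field of rational functions. -/
noncomputable def ratVar (i : ℕ) : RatField :=
  algebraMap (MvPolynomial ℕ ℂ) RatField (MvPolynomial.X i)

/-- The group `⨁_ℕ ℤ` with the lexicographic order: `g < h` if and only if `g i < h i` at the
first index `i` at which `g` and `h` differ. -/
abbrev LexGroup : Type := Lex (ℕ →₀ ℤ)

/-- The standard basis vector of index `i`. -/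
noncomputable def lexBasis (i : ℕ) : LexGroup := toLex (Finsupp.single i 1)

/-- `v` is a valuation on `K/ℂ` (that is, trivial on `ℂˣ`) with value group `⨁_ℕ ℤ` (that is,
every element of the group is a value) which sends each indeterminate to the basis vector of
the same index. By convention the value of `0` is `⊤`. -/
structure IsLexValuation (v : AddValuation RatField (WithTop LexGroup)) : Prop where
  map_const : ∀ c : ℂ, c ≠ 0 → v (algebraMap ℂ RatField c) = 0
  map_var : ∀ i : ℕ, v (ratVar i) = (lexBasis i : WithTop LexGroup)
  surj : ∀ g : LexGroup, ∃ x : RatField, v x = (g : WithTop LexGroup)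

/-- The exponent of a monomial, viewed in the value group. -/
noncomputable def expVal (d : ℕ →₀ ℕ) : LexGroup :=
  toLex (d.mapRange (fun n : ℕ => (n : ℤ)) rfl)

theorem expVal_injective : Function.Injective expVal := by
  intro d e h
  ext i
  have := DFunLike.congr_fun (toLex.injective h) i
  simpa using this

theorem expVal_eq_sum (d : ℕ →₀ ℕ) : expVal d = d.sum fun i n => n • lexBasis i := by
  induction d using Finsupp.induction_linear with
  | zero => simp [expVal]
  | add f g hf hg =>
    rw [Finsupp.sum_add_index' (by simp) (by intros; rw [add_smul]), ← hf, ← hg]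
    apply ofLex.injective
    ext i
    simp [expVal]
  | single i n =>
    rw [Finsupp.sum_single_index (by simp)]
    apply ofLex.injective
    ext j
    change _ = (n • Finsupp.single i (1 : ℤ)) j
    simp [expVal, Finsupp.single_apply]

/-- The embedding of polynomials into Hahn series with exponents in the value group. -/
noncomputable def toHahn : MvPolynomial ℕ ℂ →ₐ[ℂ] HahnSeries LexGroup ℂ :=
  MvPolynomial.aeval fun i => HahnSeries.single (lexBasis i) 1

theorem toHahn_monomial (d : ℕ →₀ ℕ) (c : ℂ) :
    toHahn (MvPolynomial.monomial d c) = HahnSeries.single (expVal d) c := by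
  have h : (d.prod fun i k => (HahnSeries.single (lexBasis i) (1 : ℂ)) ^ k) =
      HahnSeries.single (expVal d) (1 : ℂ) := by
    rw [expVal_eq_sum, Finsupp.prod, Finsupp.sum]
    induction d.support using Finset.induction_on with
    | empty => simp
    | insert a s ha ih =>
      rw [Finset.prod_insert ha, Finset.sum_insert ha, ih, HahnSeries.single_pow,
        HahnSeries.single_mul_single]
      simp
  rw [toHahn, MvPolynomial.aeval_monomial, h, HahnSeries.algebraMap_apply]
  simp [HahnSeries.C_apply, HahnSeries.single_mul_single]

theorem toHahn_coeff (p : MvPolynomial ℕ ℂ) (d : ℕ →₀ ℕ) :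
    (toHahn p).coeff (expVal d) = p.coeff d := by
  classical
  induction p using MvPolynomial.induction_on' with
  | monomial e c =>
    rw [toHahn_monomial, MvPolynomial.coeff_monomial, HahnSeries.coeff_single]
    by_cases h : e = d
    · simp [h]
    · rw [if_neg h, if_neg (fun h' => h (expVal_injective h').symm)]
  | add p q hp hq => simp [hp, hq]

theorem toHahn_injective : Function.Injective toHahn := by
  intro p q h
  ext d
  rw [← toHahn_coeff, ← toHahn_coeff, h]

/-- The extension of `toHahn` to rational functions. -/
noncomputable def ratToHahn : RatField →+* HahnSeries LexGroup ℂ :=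
  IsFractionRing.lift (A := MvPolynomial ℕ ℂ) (K := RatField) (g := toHahn.toRingHom)
    toHahn_injective

theorem ratToHahn_algebraMap (p : MvPolynomial ℕ ℂ) :
    ratToHahn (algebraMap (MvPolynomial ℕ ℂ) RatField p) = toHahn p :=
  IsFractionRing.lift_algebraMap _ p

theorem lexValuation_poly {v : AddValuation RatField (WithTop LexGroup)}
    (hc : ∀ c : ℂ, c ≠ 0 → v (algebraMap ℂ RatField c) = 0)
    (hX : ∀ i : ℕ, v (ratVar i) = (lexBasis i : WithTop LexGroup))
    (d : ℕ →₀ ℕ) (c : ℂ) (h : c ≠ 0) :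
    v (algebraMap (MvPolynomial ℕ ℂ) RatField (MvPolynomial.monomial d c)) =
      (expVal d : WithTop LexGroup) := by
  have hp : v (d.prod fun i k => ratVar i ^ k) = (expVal d : WithTop LexGroup) := by
    rw [expVal_eq_sum, Finsupp.prod, Finsupp.sum]
    induction d.support using Finset.induction_on with
    | empty => simp
    | insert a s ha ih =>
      rw [Finset.prod_insert ha, Finset.sum_insert ha, v.map_mul, ih, v.map_pow, hX]
      rfl
  have e : algebraMap (MvPolynomial ℕ ℂ) RatField (MvPolynomial.monomial d c) =
      algebraMap ℂ RatField c * d.prod fun i k => ratVar i ^ k := by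
    rw [MvPolynomial.monomial_eq, map_mul, Finsupp.prod, map_prod,
      IsScalarTower.algebraMap_apply ℂ (MvPolynomial ℕ ℂ) RatField]
    simp [ratVar, Finsupp.prod, MvPolynomial.algebraMap_eq]
  rw [e, v.map_mul, hp, hc c h, zero_add]

theorem IsLexValuation.eq {v w : AddValuation RatField (WithTop LexGroup)}
    (hv : IsLexValuation v) (hw : IsLexValuation w) : v = w := by
  classical
  have key : ∀ p : MvPolynomial ℕ ℂ, p ≠ 0 → ∃ g : LexGroup,
      ∀ u : AddValuation RatField (WithTop LexGroup), IsLexValuation u →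
        u (algebraMap (MvPolynomial ℕ ℂ) RatField p) = (g : WithTop LexGroup) := by
    intro p hp
    obtain ⟨d, hd, hmin⟩ := Finset.exists_min_image p.support expVal
      (MvPolynomial.support_nonempty.2 hp)
    refine ⟨expVal d, fun u hu => ?_⟩
    have hm := fun e (he : e ∈ p.support) =>
      lexValuation_poly hu.map_const hu.map_var e (p.coeff e) (MvPolynomial.mem_support_iff.1 he)
    conv_lhs => rw [p.as_sum, map_sum, ← Finset.add_sum_erase _ _ hd]
    rw [AddValuation.map_add_eq_of_lt_left, hm d hd]
    rw [hm d hd]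
    refine u.map_lt_sum (WithTop.coe_ne_top) fun e he => ?_
    rw [Finset.mem_erase] at he
    rw [hm e he.2, WithTop.coe_lt_coe]
    exact lt_of_le_of_ne (hmin e he.2) fun h => he.1 (expVal_injective h).symm
  ext x
  obtain ⟨p, q, hq, rfl⟩ := IsFractionRing.div_surjective (A := MvPolynomial ℕ ℂ) x
  by_cases hp : p = 0
  · simp [hp]
  obtain ⟨g, hg⟩ := key p hp
  obtain ⟨h, hh⟩ := key q (nonZeroDivisors.ne_zero hq)
  rw [AddValuation.map_div, AddValuation.map_div, hg v hv, hg w hw, hh v hv, hh w hw]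

theorem exists_lexValuation : ∃ v, IsLexValuation v := by
  let v := (HahnSeries.addVal LexGroup ℂ).comap ratToHahn
  have hv : ∀ x, v x = (ratToHahn x).orderTop := fun x => HahnSeries.addVal_apply
  have hX : ∀ i : ℕ, v (ratVar i) = (lexBasis i : WithTop LexGroup) := by
    intro i
    rw [hv, ratVar, ratToHahn_algebraMap, toHahn, MvPolynomial.aeval_X,
      HahnSeries.orderTop_single one_ne_zero]
  refine ⟨v, fun c hc => ?_, hX, fun g => ?_⟩
  · rw [hv, IsScalarTower.algebraMap_apply ℂ (MvPolynomial ℕ ℂ) RatField, ratToHahn_algebraMap,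
      AlgHom.commutes, HahnSeries.algebraMap_apply]
    simp [HahnSeries.C_apply, HahnSeries.orderTop_single, hc]
  · obtain ⟨g, rfl⟩ := toLex.surjective g
    induction g using Finsupp.induction_linear with
    | zero => exact ⟨1, by simp⟩
    | add f g hf hg =>
      obtain ⟨x, hx⟩ := hf
      obtain ⟨y, hy⟩ := hg
      exact ⟨x * y, by rw [v.map_mul, hx, hy]; rfl⟩
    | single i n =>
      have key : ∀ k : ℕ, v (ratVar i ^ k) =
          ((toLex (Finsupp.single i (k : ℤ)) : LexGroup) : WithTop LexGroup) := by
        intro k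
        rw [v.map_pow, hX, ← WithTop.coe_nsmul]
        congr 1
        apply ofLex.injective
        ext j
        change (k • Finsupp.single i (1 : ℤ)) j = _
        simp [Finsupp.single_apply]
      obtain ⟨k, rfl | rfl⟩ := n.eq_nat_or_neg
      · exact ⟨_, key k⟩
      · refine ⟨(ratVar i ^ k)⁻¹, ?_⟩
        rw [AddValuation.map_inv, key, Finsupp.single_neg]
        rfl

theorem existsUnique_lexValuation : ∃! v, IsLexValuation v :=
  exists_lexValuation.imp fun _ hv => ⟨hv, fun _ hw => hw.eq hv⟩

/-- The unique valuation on `ℂ(X₁, X₂, …)/ℂ` with value group `⨁_ℕ ℤ`, ordered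
lexicographically, that sends `X_i` to `e_i`. -/
noncomputable def lexValuation : AddValuation RatField (WithTop LexGroup) :=
  existsUnique_lexValuation.choose

theorem isLexValuation_lexValuation : IsLexValuation lexValuation :=
  existsUnique_lexValuation.choose_spec.1

/-- The valuation ring `V = {x ∈ K | 0 ≤ v x}` of the lexicographic valuation. -/
noncomputable def lexRing : ValuationSubring RatField where
  carrier := {x | 0 ≤ lexValuation x}
  mul_mem' {x y} hx hy := by
    simp only [Set.mem_ofPred_eq, lexValuation.map_mul] at *
    exact add_nonneg hx hy
  one_mem' := by simp
  add_mem' hx hy := lexValuation.map_le_add hx hy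
  zero_mem' := by simp
  neg_mem' {x} hx := by simpa using hx
  mem_or_inv_mem' x := by
    by_cases hx : x = 0
    · simp [hx]
    · have h0 : lexValuation x + lexValuation x⁻¹ = 0 := by
        rw [← lexValuation.map_mul, mul_inv_cancel₀ hx, lexValuation.map_one]
      by_contra! h
      simp only [Set.mem_ofPred_eq, not_le] at h
      have h1 : lexValuation x + lexValuation x⁻¹ < 0 + 0 :=
        WithTop.add_lt_add h.1 h.2
      rw [h0, add_zero] at h1
      exact lt_irrefl _ h1

/-- The indeterminates lie in the valuation ring. -/
theorem ratVar_mem (i : ℕ) : ratVar i ∈ lexRing := by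
  change 0 ≤ lexValuation (ratVar i)
  rw [isLexValuation_lexValuation.map_var, ← WithTop.coe_zero, WithTop.coe_le_coe]
  exact Finsupp.toLex_monotone (Finsupp.single_nonneg.2 zero_le_one)

/-- The indeterminate of index `i`, as an element of the valuation ring. -/
noncomputable def lexVar (i : ℕ) : lexRing := ⟨ratVar i, ratVar_mem i⟩

/-! ### Local cohomology with supports -/

universe u w

/-- For an abelian sheaf `F` on `X`, the sections of `F` over `X` with support in the closed set
`Z`, that is, the kernel of the restriction map `F(X) → F(X ∖ Z)`, as a functor of `F`. -/
noncomputable def sectionsWithSupport {X : TopCat.{u}} (Z : Closeds X) :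
    TopCat.Sheaf AddCommGrpCat.{u} X ⥤ AddCommGrpCat.{u} where
  obj F := kernel (F.presheaf.map (homOfLE (le_top : Z.compl ≤ ⊤)).op)
  map f := kernel.map _ _ (f.hom.app _) (f.hom.app _) (f.hom.naturality _)
  map_id F := (cancel_mono (kernel.ι _)).1 (by
    erw [kernel.lift_ι]
    rw [TopCat.Sheaf.id_app, Category.comp_id, Category.id_comp])
  map_comp f g := (cancel_mono (kernel.ι _)).1 (by
    rw [kernel.lift_ι, Category.assoc, kernel.lift_ι, kernel.lift_ι_assoc,
      TopCat.Sheaf.comp_app, Category.assoc])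

instance sectionsWithSupport_additive {X : TopCat.{u}} (Z : Closeds X) :
    (sectionsWithSupport Z).Additive where
  map_add {F G f g} := by
    apply (cancel_mono (kernel.ι (G.presheaf.map (homOfLE (le_top : Z.compl ≤ ⊤)).op))).1
    refine ((kernel.lift_ι _ _ _).trans ?_).trans (Preadditive.add_comp _ _ _ _ _ _).symm
    exact (Preadditive.comp_add _ _ _ _ _ _).trans
      (congrArg₂ (· + ·) (kernel.lift_ι _ _ _) (kernel.lift_ι _ _ _)).symm

/-- The local cohomology functors with support in `Z`: the right derived functors of
the functor of sections with support in `Z`. -/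
noncomputable def localCohomologyWithSupport {X : TopCat.{u}} (Z : Closeds X) (i : ℕ) :
    TopCat.Sheaf AddCommGrpCat.{u} X ⥤ AddCommGrpCat.{u} :=
  (sectionsWithSupport Z).rightDerived i

/-- The structure sheaf of a scheme, as a sheaf of abelian groups. -/
noncomputable def abStructureSheaf (X : Scheme.{u}) : TopCat.Sheaf AddCommGrpCat.{u} X :=
  (sheafCompose _ (forget₂ CommRingCat.{u} RingCat.{u} ⋙
    forget₂ RingCat.{u} AddCommGrpCat.{u})).obj X.sheaf

/-- The closed point of the spectrum of a local ring, as a closed subset. -/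
def closedPointSet (A : Type u) [CommRing A] [IsLocalRing A] :
    Closeds (Spec (CommRingCat.of A)) :=
  ⟨{IsLocalRing.closedPoint A}, IsLocalRing.isClosed_singleton_closedPoint A⟩

/-! ### Torsion cohomology -/

/-- The submodule `Γ_I(M) = {x ∈ M | Iⁿ x = 0 for some n}`. -/
def powerTorsion {A : Type u} [CommRing A] (I : Ideal A) (M : Type w) [AddCommGroup M]
    [Module A M] : Submodule A M where
  carrier := {x | ∃ n : ℕ, ∀ a ∈ I ^ n, a • x = 0}
  zero_mem' := ⟨0, by simp⟩
  add_mem' := by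
    rintro x y ⟨m, hm⟩ ⟨n, hn⟩
    refine ⟨m + n, fun a ha => ?_⟩
    rw [smul_add, hm a (Ideal.pow_le_pow_right (Nat.le_add_right m n) ha),
      hn a (Ideal.pow_le_pow_right (Nat.le_add_left n m) ha), add_zero]
  smul_mem' := by
    rintro c x ⟨n, hn⟩
    exact ⟨n, fun a ha => by rw [smul_comm, hn a ha, smul_zero]⟩

theorem powerTorsion_map {A : Type u} [CommRing A] (I : Ideal A) {M N : Type w}
    [AddCommGroup M] [Module A M] [AddCommGroup N] [Module A N] (f : M →ₗ[A] N) :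
    ∀ x ∈ powerTorsion I M, f x ∈ powerTorsion I N := by
  rintro x ⟨n, hn⟩
  exact ⟨n, fun a ha => by rw [← map_smul, hn a ha, map_zero]⟩

/-- The `I`-torsion functor `Γ_I` on the category of `A`-modules. -/
def torsionFunctor {A : Type u} [CommRing A] (I : Ideal A) :
    ModuleCat.{w} A ⥤ ModuleCat.{w} A where
  obj M := ModuleCat.of A (powerTorsion I M)
  map f := ModuleCat.ofHom (f.hom.restrict (powerTorsion_map I f.hom))

instance torsionFunctor_additive {A : Type u} [CommRing A] (I : Ideal A) :
    (torsionFunctor.{u, w} I).Additive where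
  map_add := rfl

/-- The `I`-torsion cohomology functors `RⁱΓ_I`: the right derived functors of `Γ_I`. -/
noncomputable def torsionCohomology {A : Type u} [CommRing A] [Small.{w} A] (I : Ideal A)
    (i : ℕ) : ModuleCat.{w} A ⥤ ModuleCat.{w} A :=
  (torsionFunctor I).rightDerived i

/-! Write `x n` for the indeterminates. In the value group every multiple of `e_{n+1}` lies below
`e_n`, and every positive element lies above some `e_n`. Hence the maximal ideal `m` is the union of
the strictly increasing chain of principal ideals `(x n)`, with `x n` in every power of `(x (n+1))`.
This is `IsLadder`, and every claim except the one on local cohomology follows from it together with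
the domain or valuation ring hypotheses.

The ideals `⋂ₖ (x n ^ k)` form an infinite chain of primes, which also shows that the cover of the
punctured spectrum by the sets `D(x n)` has no finite subcover. As a limit of copies of `A` along
multiplication maps, `m` has a free resolution of length one (`telescope_exact`). It is not
projective, since a nonzero projective ideal of a domain is finitely generated (`not_projective`).
So the residue field has projective dimension exactly 2. Since `m = m ^ k` for `k ≥ 1`, the functor
`Γ_m` is `Hom(κ, -)`, which explains the vanishing from degree 3 on; `isZero_torsionCohomology`
carries this out as a chase in an injective resolution.

For local cohomology, vanishing of `H²_Z(O)` would force `lim¹` of the tower `O(D(x n))` to vanish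
(`exists_res_eq_add_of_isZero`). Applied to the sections `1 / x n`, this would give a rational
function `f` such that `f + ∑_{i<n} 1 / x i` lies in `V[1 / x n]` for all `n`. No such `f` exists:
doubling an indeterminate absent from `f` is an automorphism preserving the valuation, and it moves
the sum by too large a term (`exists_forall_pow_mul_notMem`). -/

/-! ### Local domains whose maximal ideal is generated by an infinite ladder -/

/-- A sequence of nonzero generators of the maximal ideal of a local ring, each of which is
divisible by all the powers of the next one. -/
structure IsLadder {A : Type*} [CommRing A] [IsLocalRing A] (x : ℕ → A) : Prop where
  ne_zero : ∀ n, x n ≠ 0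
  pow_dvd : ∀ n k, x (n + 1) ^ k ∣ x n
  span_eq : IsLocalRing.maximalIdeal A = Ideal.span (Set.range x)

namespace IsLadder

variable {A : Type*} [CommRing A] [IsLocalRing A] {x : ℕ → A}

theorem dvd_of_le (h : IsLadder x) {m n : ℕ} (hmn : m ≤ n) : x n ∣ x m := by
  induction n, hmn using Nat.le_induction with
  | base => exact dvd_rfl
  | succ n _ ih => exact (by simpa using h.pow_dvd n 1 : x (n + 1) ∣ x n).trans ih

theorem pow_dvd_of_lt (h : IsLadder x) {m n : ℕ} (hmn : m < n) (k : ℕ) : x n ^ k ∣ x m := by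
  obtain ⟨n, rfl⟩ : ∃ l, n = l + 1 := ⟨n - 1, by omega⟩
  exact (h.pow_dvd n k).trans (h.dvd_of_le (by omega))

theorem mem (h : IsLadder x) (n : ℕ) : x n ∈ IsLocalRing.maximalIdeal A := by
  rw [h.span_eq]
  exact Ideal.subset_span ⟨n, rfl⟩

theorem mem_maximalIdeal_iff (h : IsLadder x) {a : A} :
    a ∈ IsLocalRing.maximalIdeal A ↔ ∃ n, x n ∣ a := by
  refine ⟨fun ha => ?_, fun ⟨n, hn⟩ => Ideal.mem_of_dvd _ hn (h.mem n)⟩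
  rw [h.span_eq] at ha
  induction ha using Submodule.span_induction with
  | mem y hy =>
    obtain ⟨n, rfl⟩ := hy
    exact ⟨n, dvd_rfl⟩
  | zero => exact ⟨0, dvd_zero _⟩
  | add y z _ _ hy hz =>
    obtain ⟨m, hm⟩ := hy
    obtain ⟨n, hn⟩ := hz
    exact ⟨max m n, dvd_add ((h.dvd_of_le (le_max_left m n)).trans hm)
      ((h.dvd_of_le (le_max_right m n)).trans hn)⟩
  | smul a y _ hy =>
    obtain ⟨n, hn⟩ := hy
    exact ⟨n, hn.mul_left a⟩

theorem not_isUnit (h : IsLadder x) (n : ℕ) : ¬ IsUnit (x n) :=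
  (IsLocalRing.mem_maximalIdeal _).1 (h.mem n)

variable [IsDomain A]

/-- Since `x n ^ 2` divides `x m`, the divisibility would give `x n ^ 2 ∣ x n` and make `x n` a
unit. -/
theorem not_dvd_of_lt (h : IsLadder x) {m n : ℕ} (hmn : m < n) : ¬ x m ∣ x n := by
  intro hd
  have h2 := (h.pow_dvd_of_lt hmn 2).trans hd
  refine h.not_isUnit n (isUnit_of_dvd_one ?_)
  rw [pow_two] at h2
  simpa using (mul_dvd_mul_iff_left (h.ne_zero n)).1 (h2.trans (by simp : x n ∣ x n * 1))

/-- Finitely many elements of the increasing union of the ideals `(x n)` already lie in one of them,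
and the next rung does not. -/
theorem not_fg (h : IsLadder x) : ¬ (IsLocalRing.maximalIdeal A).FG := by
  rintro ⟨s, hs⟩
  have hm : ∀ a ∈ s, ∃ n, x n ∣ a := fun a ha =>
    h.mem_maximalIdeal_iff.1 (hs ▸ Ideal.subset_span ha)
  choose! f hf using hm
  have hle : IsLocalRing.maximalIdeal A ≤ Ideal.span {x (s.sup f)} := by
    rw [← hs, Ideal.span_le]
    exact fun a ha => Ideal.mem_span_singleton.2
      ((h.dvd_of_le (Finset.le_sup ha)).trans (hf a ha))
  exact h.not_dvd_of_lt (Nat.lt_succ_self _) (Ideal.mem_span_singleton.1 (hle (h.mem _)))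

/-- A linear section `s` of the free cover of `m` satisfies `z • s w = w • s z`. In a domain this
bounds the support of every `s z` by that of `s y` for one fixed nonzero `y`, so finitely many
elements generate `m`, against `not_fg`. -/
theorem not_projective (h : IsLadder x) :
    ¬ Module.Projective A (IsLocalRing.maximalIdeal A) := by
  classical
  intro hp
  set m := IsLocalRing.maximalIdeal A
  obtain ⟨s, hs⟩ := Module.projective_def'.1 hp
  let y : m := ⟨x 0, h.mem 0⟩
  have hcomm : ∀ z w : m, (z : A) • s w = (w : A) • s z := fun z w => by
    rw [← map_smul, ← map_smul]
    congr 1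
    ext
    simp [mul_comm]
  have hsupp : ∀ z : m, (s z).support ⊆ (s y).support := fun z i hi => by
    rw [Finsupp.mem_support_iff] at hi ⊢
    intro h0
    have := DFunLike.congr_fun (hcomm y z) i
    simp only [Finsupp.smul_apply, h0, smul_eq_mul, mul_zero, mul_eq_zero] at this
    exact this.elim (h.ne_zero 0) hi
  refine h.not_fg ⟨(s y).support.image (fun z : m => (z : A)), le_antisymm ?_ ?_⟩
  · rw [Ideal.span_le]
    intro a ha
    obtain ⟨z, -, rfl⟩ := Finset.mem_image.1 (Finset.mem_coe.1 ha)
    exact z.2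
  · intro a ha
    have hz := congrArg (fun z : m => (z : A)) (LinearMap.congr_fun hs ⟨a, ha⟩)
    simp only [LinearMap.comp_apply, LinearMap.id_apply, Finsupp.linearCombination_apply,
      Finsupp.sum, AddSubmonoidClass.coe_finsetSum, id_eq, Submodule.coe_smul] at hz
    rw [← hz]
    refine Ideal.sum_mem _ fun i hi => ?_
    exact Ideal.mul_mem_left _ _ (Ideal.subset_span (Finset.mem_coe.2
      (Finset.mem_image_of_mem _ (hsupp _ hi))))

/-! ### An infinite strictly increasing chain of primes -/

section Primes

variable {A : Type*} [CommRing A] [IsDomain A] [ValuationRing A] {x : ℕ → A}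

/-- The prime ideal of the elements divisible by all the powers of the `n`-th rung. -/
def prime (h : IsLadder x) (n : ℕ) : PrimeSpectrum A where
  asIdeal :=
    { carrier := {a | ∀ k, x n ^ k ∣ a}
      add_mem' := fun ha hb k => dvd_add (ha k) (hb k)
      zero_mem' := fun k => dvd_zero _
      smul_mem' := fun c a ha k => (ha k).mul_left c }
  isPrime := by
    have hu : ∀ k, ¬ x n ^ (k + 1) ∣ x n ^ k := fun k hk => by
      refine h.not_isUnit n (isUnit_of_dvd_one ?_)
      rw [pow_succ] at hk
      exact (mul_dvd_mul_iff_left (pow_ne_zero k (h.ne_zero n))).1 (by simpa using hk)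
    refine Ideal.isPrime_iff.2 ⟨fun ht => ?_, fun {a b} hab => ?_⟩
    · have h1 : ∀ k, x n ^ k ∣ (1 : A) := (Ideal.eq_top_iff_one _).1 ht
      exact hu 0 (by simpa using h1 1)
    · by_contra! hc
      obtain ⟨ha, hb⟩ := hc
      obtain ⟨k, hk⟩ := not_forall.1 (show ¬ ∀ k, x n ^ k ∣ a from ha)
      obtain ⟨l, hl⟩ := not_forall.1 (show ¬ ∀ k, x n ^ k ∣ b from hb)
      -- Divisibility is total, so a power of `x n` that fails to divide `a` is a multiple of `a`,
      -- and likewise for `b`. Then `a * b` divides a power of `x n`, which rules out divisibility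
      -- by the next power.
      have hk' := (ValuationRing.dvd_total (x n ^ k) a).resolve_left hk
      have hl' := (ValuationRing.dvd_total (x n ^ l) b).resolve_left hl
      have h3 : a * b ∣ x n ^ (k + l) := by
        rw [pow_add]
        exact mul_dvd_mul hk' hl'
      exact hu _ ((show ∀ k, x n ^ k ∣ a * b from hab) (k + l + 1) |>.trans h3)

theorem mem_prime (h : IsLadder x) {n : ℕ} {a : A} :
    a ∈ (h.prime n).asIdeal ↔ ∀ k, x n ^ k ∣ a := Iff.rfl

/-- The rungs separate these primes; this gives both the strictness of the chain and the failure of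
compactness of the punctured spectrum. -/
theorem mem_prime_iff_lt (h : IsLadder x) {m n : ℕ} : x m ∈ (h.prime n).asIdeal ↔ m < n := by
  refine ⟨fun hm => ?_, fun hmn => h.mem_prime.2 (h.pow_dvd_of_lt hmn)⟩
  by_contra! hnm
  have h2 := (h.mem_prime.1 hm 2).trans (h.dvd_of_le hnm)
  refine h.not_isUnit n (isUnit_of_dvd_one ?_)
  rw [pow_two] at h2
  exact (mul_dvd_mul_iff_left (h.ne_zero n)).1 (by simpa using h2)

theorem prime_strictMono (h : IsLadder x) : StrictMono h.prime := by
  refine strictMono_nat_of_lt_succ fun n => lt_of_le_not_ge (fun a ha => ?_) fun hle => ?_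
  · rw [h.mem_prime] at ha ⊢
    exact fun k => (h.pow_dvd n k).trans (by simpa using ha 1)
  · exact lt_irrefl n (h.mem_prime_iff_lt.1 (hle (h.mem_prime_iff_lt.2 n.lt_succ_self)))

theorem ringKrullDim_eq_top (h : IsLadder x) : ringKrullDim A = ⊤ := by
  have : InfiniteDimensionalOrder (PrimeSpectrum A) := ⟨fun n =>
    ⟨⟨n, fun i => h.prime i, fun i => h.prime_strictMono (by simp)⟩, rfl⟩⟩
  exact Order.krullDim_eq_top

end Primes

end IsLadder

/-! ### The indeterminates form a ladder in the valuation ring -/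

theorem nsmul_lexBasis_lt {m n : ℕ} (h : m < n) (k : ℕ) : k • lexBasis n < lexBasis m := by
  rw [Finsupp.Lex.lt_iff]
  refine ⟨m, fun j hj => ?_, ?_⟩
  · change (k • Finsupp.single n (1 : ℤ)) j = Finsupp.single m (1 : ℤ) j
    simp [hj.ne', (hj.trans h).ne']
  · change (k • Finsupp.single n (1 : ℤ)) m < Finsupp.single m (1 : ℤ) m
    simp [h.ne']

theorem exists_lexBasis_le {g : LexGroup} (hg : 0 < g) : ∃ n, lexBasis n ≤ g := by
  obtain ⟨i, hi, hpos⟩ := Finsupp.Lex.lt_iff.1 hg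
  -- With `i` the first index where `g` is nonzero, `e_i` need not lie below `g` (take `g = e_i -
  -- e_{i+1}`), but `e_{i+1}` does, as its coordinate at `i` is zero.
  refine ⟨i + 1, le_of_lt (Finsupp.Lex.lt_iff.2 ⟨i, fun j hj => ?_, ?_⟩)⟩
  · rw [← hi j hj]
    change Finsupp.single (i + 1) (1 : ℤ) j = 0
    simp [(hj.trans i.lt_succ_self).ne']
  · refine lt_of_eq_of_lt ?_ hpos
    change Finsupp.single (i + 1) (1 : ℤ) i = 0
    simp

theorem mem_lexRing_iff {f : RatField} : f ∈ lexRing ↔ 0 ≤ lexValuation f := Iff.rfl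

theorem lexValuation_ratVar (i : ℕ) :
    lexValuation (ratVar i) = (lexBasis i : WithTop LexGroup) :=
  isLexValuation_lexValuation.map_var i

theorem lexValuation_ratVar_pow (i k : ℕ) :
    lexValuation (ratVar i ^ k) = ((k • lexBasis i : LexGroup) : WithTop LexGroup) := by
  rw [AddValuation.map_pow, lexValuation_ratVar, WithTop.coe_nsmul]

theorem ratVar_ne_zero (i : ℕ) : ratVar i ≠ 0 := fun h => by
  have := lexValuation_ratVar i
  rw [h, AddValuation.map_zero] at this
  exact WithTop.top_ne_coe this

theorem lexRing_dvd_iff {a b : lexRing} (ha : a ≠ 0) :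
    a ∣ b ↔ lexValuation (a : RatField) ≤ lexValuation (b : RatField) := by
  have ha' : (a : RatField) ≠ 0 := fun h => ha (Subtype.ext h)
  constructor
  · rintro ⟨c, rfl⟩
    rw [MulMemClass.coe_mul, AddValuation.map_mul]
    exact le_add_of_nonneg_right (mem_lexRing_iff.1 c.2)
  · intro h
    have hc : (b : RatField) / a ∈ lexRing := by
      rw [mem_lexRing_iff, ← WithTop.add_le_add_iff_left (x := lexValuation (a : RatField))
        (fun ht => ha' ((AddValuation.top_iff _).1 ht)), ← AddValuation.map_mul,
        mul_div_cancel₀ _ ha', add_zero]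
      exact h
    exact ⟨⟨_, hc⟩, Subtype.ext (mul_div_cancel₀ _ ha').symm⟩

theorem lexVar_ne_zero (i : ℕ) : lexVar i ≠ 0 := fun h =>
  ratVar_ne_zero i (congrArg Subtype.val h)

theorem isLadder_lexVar : IsLadder lexVar where
  ne_zero := lexVar_ne_zero
  pow_dvd n k := by
    rw [lexRing_dvd_iff (pow_ne_zero _ (lexVar_ne_zero _))]
    change lexValuation (ratVar (n + 1) ^ k) ≤ lexValuation (ratVar n)
    rw [lexValuation_ratVar_pow, lexValuation_ratVar, WithTop.coe_le_coe]
    exact (nsmul_lexBasis_lt n.lt_succ_self k).le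
  span_eq := by
    refine le_antisymm (fun a ha => ?_) (Ideal.span_le.2 ?_)
    · by_cases h0 : a = 0
      · rw [h0]
        exact zero_mem _
      have h1 : ¬ lexValuation (a : RatField) ≤ 0 := fun h => by
        refine (IsLocalRing.mem_maximalIdeal _).1 ha (isUnit_of_dvd_one ?_)
        rw [lexRing_dvd_iff h0]
        simpa using h
      have ht : lexValuation (a : RatField) ≠ ⊤ := fun ht =>
        h0 (Subtype.ext ((AddValuation.top_iff _).1 ht))
      obtain ⟨g, hg⟩ := WithTop.ne_top_iff_exists.1 ht
      rw [← hg, ← WithTop.coe_zero, WithTop.coe_le_coe, not_le] at h1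
      obtain ⟨n, hn⟩ := exists_lexBasis_le h1
      refine Ideal.mem_of_dvd _ ?_ (Ideal.subset_span ⟨n, rfl⟩)
      rw [lexRing_dvd_iff (lexVar_ne_zero n), ← hg]
      change lexValuation (ratVar n) ≤ _
      rwa [lexValuation_ratVar, WithTop.coe_le_coe]
    · rintro _ ⟨n, rfl⟩
      refine (IsLocalRing.mem_maximalIdeal _).2 fun hu => ?_
      have h1 := (lexRing_dvd_iff (b := 1) (lexVar_ne_zero n)).1 hu.dvd
      change lexValuation (ratVar n) ≤ lexValuation 1 at h1
      rw [lexValuation_ratVar, AddValuation.map_one, ← WithTop.coe_zero, WithTop.coe_le_coe] at h1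
      exact not_le_of_gt (by simpa using nsmul_lexBasis_lt n.lt_succ_self 0 :
        (0 : LexGroup) < lexBasis n) h1

/-! ### A pseudo-convergent sequence without limit -/

/-- The endomorphism of the polynomial ring that multiplies the indeterminate of index `m`
by `c`. -/
noncomputable def scaleVar (m : ℕ) (c : ℂ) : MvPolynomial ℕ ℂ →ₐ[ℂ] MvPolynomial ℕ ℂ :=
  MvPolynomial.aeval fun i => MvPolynomial.C (if i = m then c else 1) * MvPolynomial.X i

theorem scaleVar_X (m : ℕ) (c : ℂ) (i : ℕ) : scaleVar m c (MvPolynomial.X i) =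
    MvPolynomial.C (if i = m then c else 1) * MvPolynomial.X i :=
  MvPolynomial.aeval_X _ _

theorem scaleVar_C (m : ℕ) (c a : ℂ) :
    scaleVar m c (MvPolynomial.C a) = MvPolynomial.C a :=
  (scaleVar m c).commutes a

theorem scaleVar_comp (m : ℕ) {c d : ℂ} (h : d * c = 1) :
    (scaleVar m c).comp (scaleVar m d) = AlgHom.id ℂ _ := by
  refine MvPolynomial.algHom_ext fun i => ?_
  rw [AlgHom.comp_apply, scaleVar_X, map_mul, scaleVar_C, scaleVar_X, ← mul_assoc,
    ← MvPolynomial.C_mul]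
  split_ifs <;> simp [h]

theorem scaleVar_of_notMem_vars {m : ℕ} (c : ℂ) {p : MvPolynomial ℕ ℂ} (h : m ∉ p.vars) :
    scaleVar m c p = p := by
  refine (MvPolynomial.hom_congr_vars (f₁ := (scaleVar m c).toRingHom) (f₂ := RingHom.id _)
    (p₁ := p) ?_ (fun i hi _ => ?_) rfl)
  · ext a
    simp
  · have : i ≠ m := fun him => h (him ▸ hi)
    simp [scaleVar_X, this]

/-- The automorphism of the field of rational functions that doubles the indeterminate of
index `m`. -/
noncomputable def doubleVar (m : ℕ) : RatField ≃+* RatField :=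
  IsFractionRing.ringEquivOfRingEquiv (A := MvPolynomial ℕ ℂ) (B := MvPolynomial ℕ ℂ)
    (AlgEquiv.ofAlgHom (scaleVar m 2) (scaleVar m 2⁻¹) (scaleVar_comp m (by norm_num))
      (scaleVar_comp m (by norm_num))).toRingEquiv

theorem doubleVar_algebraMap (m : ℕ) (p : MvPolynomial ℕ ℂ) :
    doubleVar m (algebraMap _ RatField p) = algebraMap _ RatField (scaleVar m 2 p) :=
  IsFractionRing.ringEquivOfRingEquiv_algebraMap _ _

theorem doubleVar_const (m : ℕ) (c : ℂ) :
    doubleVar m (algebraMap ℂ RatField c) = algebraMap ℂ RatField c := by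
  rw [IsScalarTower.algebraMap_apply ℂ (MvPolynomial ℕ ℂ) RatField, doubleVar_algebraMap,
    AlgHom.commutes]

theorem doubleVar_ratVar (m i : ℕ) : doubleVar m (ratVar i) =
    algebraMap ℂ RatField (if i = m then 2 else 1) * ratVar i := by
  rw [ratVar, doubleVar_algebraMap, scaleVar_X, map_mul,
    IsScalarTower.algebraMap_apply ℂ (MvPolynomial ℕ ℂ) RatField, MvPolynomial.algebraMap_eq]

theorem IsLexValuation.comap_ringEquiv {v : AddValuation RatField (WithTop LexGroup)}
    (hv : IsLexValuation v) (σ : RatField ≃+* RatField)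
    (hσ : ∀ c : ℂ, σ (algebraMap ℂ RatField c) = algebraMap ℂ RatField c)
    (hX : ∀ i : ℕ, v (σ (ratVar i)) = (lexBasis i : WithTop LexGroup)) :
    IsLexValuation (v.comap (σ : RatField →+* RatField)) where
  map_const c hc := (congrArg v (hσ c)).trans (hv.map_const c hc)
  map_var := hX
  surj g := by
    obtain ⟨f, hf⟩ := hv.surj g
    exact ⟨σ.symm f, (congrArg v (σ.apply_symm_apply f)).trans hf⟩

theorem lexValuation_doubleVar_ratVar (m i : ℕ) :
    lexValuation (doubleVar m (ratVar i)) = (lexBasis i : WithTop LexGroup) := by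
  have hc : (if i = m then (2 : ℂ) else 1) ≠ 0 := by split_ifs <;> norm_num
  rw [doubleVar_ratVar, AddValuation.map_mul, isLexValuation_lexValuation.map_const _ hc,
    zero_add, lexValuation_ratVar]

/-- Composing with the automorphism gives a valuation with the same characterizing properties, so
uniqueness identifies the two. -/
theorem lexValuation_doubleVar (m : ℕ) (f : RatField) :
    lexValuation (doubleVar m f) = lexValuation f :=
  DFunLike.congr_fun ((isLexValuation_lexValuation.comap_ringEquiv (doubleVar m)
    (doubleVar_const m) (lexValuation_doubleVar_ratVar m)).eq isLexValuation_lexValuation) f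

theorem exists_doubleVar_eq (f : RatField) : ∃ m, doubleVar m f = f := by
  obtain ⟨p, q, -, rfl⟩ := IsFractionRing.div_surjective (A := MvPolynomial ℕ ℂ) f
  obtain ⟨m, hm⟩ := Infinite.exists_notMem_finset (p.vars ∪ q.vars)
  rw [Finset.notMem_union] at hm
  exact ⟨m, by rw [map_div₀, doubleVar_algebraMap, doubleVar_algebraMap,
    scaleVar_of_notMem_vars 2 hm.1, scaleVar_of_notMem_vars 2 hm.2]⟩

/-- The series of the inverses of the indeterminates has no sum in the field of rational
functions. -/
theorem exists_forall_pow_mul_notMem (f : RatField) : ∃ n, ∀ k,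
    ratVar n ^ k * (f + ∑ i ∈ Finset.range n, (ratVar i)⁻¹) ∉ lexRing := by
  -- The rational function `f` involves finitely many indeterminates. Doubling another one, of index
  -- `m`, fixes `f` and changes only the last term of the sum up to `m`.
  obtain ⟨m, hm⟩ := exists_doubleVar_eq f
  refine ⟨m + 1, fun k hk => ?_⟩
  set s := f + ∑ i ∈ Finset.range (m + 1), (ratVar i)⁻¹
  have hX : doubleVar m (ratVar (m + 1)) = ratVar (m + 1) := by simp [doubleVar_ratVar]
  have hs : doubleVar m s - s = (algebraMap ℂ RatField (-2⁻¹)) * (ratVar m)⁻¹ := by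
    have h1 : ∀ i ∈ Finset.range m, doubleVar m (ratVar i)⁻¹ = (ratVar i)⁻¹ := fun i hi => by
      rw [map_inv₀, doubleVar_ratVar, if_neg (Finset.mem_range.1 hi).ne, map_one, one_mul]
    simp only [s, map_add, hm, map_sum, Finset.sum_range_succ, Finset.sum_congr rfl h1]
    rw [map_inv₀, doubleVar_ratVar, if_pos rfl, mul_inv, map_neg, map_inv₀, map_ofNat]
    ring
  have hk' : doubleVar m (ratVar (m + 1) ^ k * s) ∈ lexRing := by
    rw [mem_lexRing_iff, lexValuation_doubleVar]
    exact hk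
  -- The difference is `-½ X_{m+1}^k / X_m`, whose value `k e_{m+1} - e_m` is negative.
  have h := sub_mem hk' hk
  rw [map_mul, map_pow, hX, ← mul_sub, hs, mem_lexRing_iff, AddValuation.map_mul,
    AddValuation.map_mul, isLexValuation_lexValuation.map_const _ (by norm_num), zero_add,
    ← AddValuation.map_mul, ← WithTop.add_le_add_iff_left (x := lexValuation (ratVar m))
      (by rw [lexValuation_ratVar]; exact WithTop.coe_ne_top), ← AddValuation.map_mul,
    mul_left_comm, mul_inv_cancel₀ (ratVar_ne_zero m), mul_one, add_zero, lexValuation_ratVar,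
    lexValuation_ratVar_pow, WithTop.coe_le_coe] at h
  exact not_le_of_gt (nsmul_lexBasis_lt m.lt_succ_self k) h

/-! ### The projective dimension of the residue field -/

section Telescope

variable {A : Type*} [CommRing A]

/-- The endomorphism `e n ↦ e n - r n • e (n + 1)` of the free module on `ℕ`. -/
noncomputable def telescope (r : ℕ → A) : (ℕ →₀ A) →ₗ[A] (ℕ →₀ A) :=
  Finsupp.linearCombination A fun n => Finsupp.single n 1 - Finsupp.single (n + 1) (r n)

theorem telescope_apply_zero (r : ℕ → A) (a : ℕ →₀ A) : telescope r a 0 = a 0 := by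
  induction a using Finsupp.induction_linear with
  | zero => simp
  | add f g hf hg => simp [hf, hg]
  | single n c => simp [telescope, Finsupp.single_apply]

theorem telescope_apply_succ (r : ℕ → A) (a : ℕ →₀ A) (n : ℕ) :
    telescope r a (n + 1) = a (n + 1) - r n * a n := by
  induction a using Finsupp.induction_linear with
  | zero => simp
  | add f g hf hg =>
    simp only [map_add, Finsupp.add_apply, hf, hg]
    ring
  | single m c =>
    by_cases h : m = n
    · subst h
      simp [telescope, mul_comm]
    · simp [telescope, Finsupp.single_apply, h]

theorem telescope_injective (r : ℕ → A) : Function.Injective (telescope r) := by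
  refine (injective_iff_map_eq_zero _).2 fun a ha => Finsupp.ext fun n => ?_
  induction n with
  | zero => rw [← telescope_apply_zero r, ha]
  | succ n ih =>
    have := telescope_apply_succ r a n
    rw [ha, ih] at this
    simpa using this.symm

theorem telescope_exact [IsDomain A] {r x : ℕ → A} (hx : ∀ n, x n ≠ 0)
    (hr : ∀ n, x n = r n * x (n + 1)) (b : ℕ →₀ A) :
    Finsupp.linearCombination A x b = 0 ↔ ∃ a, telescope r a = b := by
  constructor
  · intro hb
    -- The equation `telescope r a = b` forces this recursion. The invariant `ha` identifies `a n *
    -- x n` with a partial sum of the vanishing combination, so `a n = 0` once the support of `b` is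
    -- exhausted.
    let a : ℕ → A := fun n => Nat.rec (b 0) (fun n y => b (n + 1) + r n * y) n
    have ha : ∀ n, a n * x n = ∑ k ∈ Finset.range (n + 1), b k * x k := by
      intro n
      induction n with
      | zero => simp [a]
      | succ n ih =>
        rw [Finset.sum_range_succ, ← ih, hr n]
        change (b (n + 1) + r n * a n) * _ = _
        ring
    obtain ⟨N, hN⟩ : ∃ N, b.support ⊆ Finset.range N := Finset.exists_nat_subset_range _
    have ha0 : ∀ n, a n ≠ 0 → n ∈ Finset.range N := fun n hn => by
      by_contra hnN
      refine hn ((mul_eq_zero.1 ?_).resolve_right (hx n))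
      rw [ha, ← hb, Finsupp.linearCombination_apply]
      refine (Finsupp.sum_of_support_subset b (hN.trans ?_) (fun k c => c • x k)
        (fun _ _ => zero_smul _ _)).symm
      exact Finset.range_subset_range.2 ((not_lt.1 fun h => hnN (Finset.mem_range.2 h)).trans
        n.le_succ)
    refine ⟨Finsupp.onFinset _ a ha0, Finsupp.ext fun n => ?_⟩
    cases n with
    | zero => rw [telescope_apply_zero]; rfl
    | succ n =>
      rw [telescope_apply_succ]
      change b (n + 1) + r n * a n - r n * a n = _
      ring
  · rintro ⟨a, rfl⟩
    induction a using Finsupp.induction_linear with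
    | zero => simp
    | add f g hf hg => simp [hf, hg]
    | single n c => simp [telescope, hr n]

end Telescope

/-- Injective modules over a domain are divisible: the map `(a) → Q` sending `a` to `q` extends to
`A`, and the image of `1` is the required element. -/
theorem Module.Baer.exists_smul_eq {A : Type u} [CommRing A] [IsDomain A] {Q : Type w}
    [AddCommGroup Q] [Module A Q] (hQ : Module.Baer A Q) {a : A} (ha : a ≠ 0) (q : Q) : ∃ y : Q, a • y = q := by
  obtain ⟨g, hg⟩ := hQ (Ideal.span {a})
    (LinearMap.toSpanSingleton A Q q ∘ₗ (LinearEquiv.toSpanNonzeroSingleton A A a ha).symm)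
  refine ⟨g 1, ?_⟩
  rw [← map_smul, smul_eq_mul, mul_one, hg a (Ideal.mem_span_singleton_self a)]
  have : (LinearEquiv.toSpanNonzeroSingleton A A a ha).symm
      ⟨a, Ideal.mem_span_singleton_self a⟩ = 1 := by
    rw [LinearEquiv.symm_apply_eq]
    ext
    simp
  simp only [LinearMap.comp_apply, LinearEquiv.coe_coe, this]
  simp

namespace IsLadder

section ProjectiveDimension

variable {A : Type u} [CommRing A] [IsDomain A] [IsLocalRing A] {x : ℕ → A}

/-- The ideal is the limit of `A → A → ⋯` along multiplication by the quotients `r n = x n / x (n +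
1)`, and the telescope is the resulting free resolution of length one. -/
theorem hasProjectiveDimensionLT_maximalIdeal (h : IsLadder x) :
    HasProjectiveDimensionLT (ModuleCat.of A (IsLocalRing.maximalIdeal A)) 2 := by
  have hr : ∀ n, ∃ r, x n = r * x (n + 1) := fun n => by
    obtain ⟨c, hc⟩ := h.dvd_of_le n.le_succ
    exact ⟨c, by rw [hc, mul_comm]⟩
  choose r hr using hr
  let y : ℕ → IsLocalRing.maximalIdeal A := fun n => ⟨x n, h.mem n⟩
  have hy : ∀ b, (Finsupp.linearCombination A y b : A) = Finsupp.linearCombination A x b :=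
    fun b => by
      rw [← Submodule.subtype_apply, ← LinearMap.comp_apply]
      congr 1
      ext n
      simp [y]
  have hzero : Finsupp.linearCombination A y ∘ₗ telescope r = 0 := LinearMap.ext fun a =>
    Subtype.ext ((hy _).trans ((telescope_exact h.ne_zero hr _).2 ⟨a, rfl⟩))
  let S : ShortComplex (ModuleCat A) := ShortComplex.mk (ModuleCat.ofHom (telescope r))
    (ModuleCat.ofHom (Finsupp.linearCombination A y))
    (by rw [← ModuleCat.ofHom_comp, hzero]; rfl)
  have hS : S.ShortExact :=
    { exact := (ShortComplex.moduleCat_exact_iff S).2 fun b hb =>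
        (telescope_exact h.ne_zero hr b).1 ((hy b).symm.trans (congrArg Subtype.val hb))
      mono_f := (ModuleCat.mono_iff_injective _).2 (telescope_injective r)
      epi_g := (ModuleCat.epi_iff_surjective _).2 fun a => by
        obtain ⟨n, c, hc⟩ := h.mem_maximalIdeal_iff.1 a.2
        refine ⟨Finsupp.single n c, Subtype.ext ?_⟩
        refine (hy _).trans ?_
        simp [hc, mul_comm] }
  have hfree : Projective (ModuleCat.of A (ℕ →₀ A)) :=
    ModuleCat.projective_of_free (Finsupp.basisSingleOne)
  exact (hS.hasProjectiveDimensionLT_X₃_iff 0 hfree).2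
    (projective_iff_hasProjectiveDimensionLT_one.1 hfree)

/-- Dimension shifting along `0 → m → A → κ → 0`: the upper bound comes from the telescope, the
lower bound from the non-projectivity of `m`. -/
theorem projectiveDimension_residueField (h : IsLadder x) :
    projectiveDimension (ModuleCat.of A (IsLocalRing.ResidueField A)) = 2 := by
  let S : ShortComplex (ModuleCat A) := ShortComplex.mk
    (ModuleCat.ofHom (IsLocalRing.maximalIdeal A).subtype)
    (ModuleCat.ofHom (Algebra.linearMap A (IsLocalRing.ResidueField A)))
    (by
      ext a
      exact (IsLocalRing.residue_eq_zero_iff (a : A)).2 a.2)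
  have hS : S.ShortExact :=
    { exact := (ShortComplex.moduleCat_exact_iff S).2 fun a ha =>
        ⟨⟨a, (IsLocalRing.residue_eq_zero_iff a).1 ha⟩, rfl⟩
      mono_f := (ModuleCat.mono_iff_injective _).2 Subtype.val_injective
      epi_g := (ModuleCat.epi_iff_surjective _).2 IsLocalRing.residue_surjective }
  have hfree : Projective (ModuleCat.of A A) :=
    (IsProjective.iff_projective A).1 inferInstance
  refine le_antisymm ?_ ?_
  · exact (projectiveDimension_le_iff _ 2).2
      ((hS.hasProjectiveDimensionLT_X₃_iff 1 hfree).2 h.hasProjectiveDimensionLT_maximalIdeal)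
  · refine (projectiveDimension_ge_iff _ 2).2 fun hlt => h.not_projective ?_
    have h1 := (hS.hasProjectiveDimensionLT_X₃_iff 0 hfree).1 hlt
    exact (IsProjective.iff_projective _).2 (projective_iff_hasProjectiveDimensionLT_one.2 h1)

end ProjectiveDimension

/-! ### Vanishing of torsion cohomology -/

section Torsion

variable {A : Type u} [CommRing A] [IsLocalRing A] {x : ℕ → A}

/-- Each `x n` is a multiple of `x (n + 1) ^ k`, hence lies in every power of `m`. Power torsion is
therefore plain annihilation by `m`. -/
theorem mem_powerTorsion_iff (h : IsLadder x) {M : Type w} [AddCommGroup M] [Module A M] {y : M} :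
    y ∈ powerTorsion (IsLocalRing.maximalIdeal A) M ↔ ∀ n, x n • y = 0 := by
  constructor
  · rintro ⟨k, hk⟩ n
    obtain ⟨c, hc⟩ := h.pow_dvd n k
    rw [hc, mul_comm, mul_smul, hk _ (Ideal.pow_mem_pow (h.mem _) k), smul_zero]
  · refine fun hy => ⟨1, fun a ha => ?_⟩
    rw [pow_one] at ha
    obtain ⟨n, c, rfl⟩ := h.mem_maximalIdeal_iff.1 ha
    rw [mul_comm, mul_smul, hy, smul_zero]

variable [IsDomain A]

/-- A compatible system of elements of an injective module, indexed by a ladder, is given by the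
multiples of a single element. -/
theorem exists_forall_smul_eq (h : IsLadder x) {Q : Type w} [AddCommGroup Q] [Module A Q]
    (hQ : Module.Baer A Q) {r : ℕ → A} (hr : ∀ n, x n = r n * x (n + 1)) {z : ℕ → Q}
    (hz : ∀ n, r n • z (n + 1) = z n) : ∃ y : Q, ∀ n, x n • y = z n := by
  have hR : ∀ {m n : ℕ}, m ≤ n → ∃ R, x m = R * x n ∧ z m = R • z n := by
    intro m n hmn
    induction n, hmn using Nat.le_induction with
    | base => exact ⟨1, by simp⟩
    | succ n _ ih =>
      obtain ⟨R, h1, h2⟩ := ih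
      exact ⟨R * r n, by rw [h1, hr n, mul_assoc], by rw [h2, ← hz n, mul_smul]⟩
  -- The system should define a linear map `m → Q` by `c * x n ↦ c • z n`. Independence of the
  -- representation follows by passing to a common index and cancelling. The value at `1` of an
  -- extension to `A` is then the desired element.
  have hwd : ∀ {m n : ℕ} {c d : A}, c * x m = d * x n → c • z m = d • z n := by
    intro m n c d hcd
    obtain ⟨R, h1, h2⟩ := hR (le_max_left m n)
    obtain ⟨S, h3, h4⟩ := hR (le_max_right m n)
    rw [h1, h3, ← mul_assoc, ← mul_assoc] at hcd
    rw [h2, h4, smul_smul, smul_smul, mul_right_cancel₀ (h.ne_zero _) hcd]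
  have hex : ∀ a : IsLocalRing.maximalIdeal A, ∃ n c, (a : A) = c * x n := fun a => by
    obtain ⟨n, c, hc⟩ := h.mem_maximalIdeal_iff.1 a.2
    exact ⟨n, c, by rw [hc, mul_comm]⟩
  choose N C hNC using hex
  let f : IsLocalRing.maximalIdeal A →ₗ[A] Q :=
    { toFun := fun a => C a • z (N a)
      map_add' := fun a b => by
        obtain ⟨R, h1, h2⟩ := hR (le_max_left (N a) (N b))
        obtain ⟨S, h3, h4⟩ := hR (le_max_right (N a) (N b))
        rw [h2, h4, smul_smul, smul_smul, ← add_smul]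
        refine hwd ?_
        rw [← hNC, add_mul, mul_assoc, mul_assoc, ← h1, ← h3, ← hNC, ← hNC]
        rfl
      map_smul' := fun c a => by
        rw [RingHom.id_apply, smul_smul]
        refine hwd ?_
        rw [← hNC, mul_assoc, ← hNC]
        rfl }
  obtain ⟨g, hg⟩ := hQ _ f
  refine ⟨g 1, fun n => ?_⟩
  rw [← map_smul, smul_eq_mul, mul_one, hg _ (h.mem n)]
  refine (hwd (d := 1) ?_).trans (one_smul _ _)
  rw [← hNC, one_mul]

/-- A torsion cocycle `s` in degree `j + 3` is the boundary of some `y`, and `y` has to be corrected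
by a boundary `d t` so as to be killed by `m`. Finding `t` uses the injective modules in degrees `j`
and `j + 1`, whence the bound 3. -/
theorem isZero_torsionCohomology [Small.{w} A] (h : IsLadder x) (M : ModuleCat.{w} A) {i : ℕ}
    (hi : 3 ≤ i) :
    IsZero ((torsionCohomology.{u, w} (IsLocalRing.maximalIdeal A) i).obj M) := by
  obtain ⟨j, rfl⟩ := Nat.exists_eq_add_of_le' hi
  let I := InjectiveResolution.of M
  have hB : ∀ n, Module.Baer A (I.cocomplex.X n) := fun n =>
    have : Injective (ModuleCat.of A (I.cocomplex.X n)) := I.injective n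
    Module.Baer.of_injective (Module.injective_module_of_injective_object A _)
  have hex : ∀ n (y : I.cocomplex.X (n + 1)), I.cocomplex.d (n + 1) (n + 2) y = 0 →
      ∃ z, I.cocomplex.d n (n + 1) z = y := fun n =>
    (ShortComplex.moduleCat_exact_iff _).1
      ((I.cocomplex.exactAt_iff' n (n + 1) (n + 2) (by simp) (by simp)).1
        (I.cocomplex_exactAt_succ n))
  have hdd : ∀ n y, I.cocomplex.d (n + 1) (n + 2) (I.cocomplex.d n (n + 1) y) = 0 := fun n y => by
    rw [← ModuleCat.comp_apply, I.cocomplex.d_comp_d]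
    rfl
  have hr : ∀ n, ∃ r, x n = r * x (n + 1) := fun n => by
    obtain ⟨c, hc⟩ := h.dvd_of_le n.le_succ
    exact ⟨c, by rw [hc, mul_comm]⟩
  choose r hr using hr
  have hr0 : ∀ n, r n ≠ 0 := fun n h0 => h.ne_zero n (by rw [hr n, h0, zero_mul])
  refine IsZero.of_iso ?_ (I.isoRightDerivedObj (torsionFunctor _) (j + 3))
  refine (HomologicalComplex.exactAt_iff_isZero_homology _ _).1 ?_
  rw [HomologicalComplex.exactAt_iff' _ (j + 2) (j + 3) (j + 4) (by simp) (by simp),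
    ShortComplex.moduleCat_exact_iff]
  rintro ⟨s, hs⟩ hds
  have hds' : I.cocomplex.d (j + 3) (j + 4) s = 0 := congrArg Subtype.val hds
  have hs' := h.mem_powerTorsion_iff.1 hs
  obtain ⟨y, rfl⟩ := hex _ s hds'
  -- The element `t` has to satisfy `x n • d t = x n • y`. Primitives `z n` of `x n • y` are
  -- candidates for `x n • t`, but they are compatible along the ladder only up to boundaries `d (v
  -- n)`.
  have hz : ∀ n, ∃ z, I.cocomplex.d (j + 1) (j + 2) z = x n • y := fun n =>
    hex _ _ (by rw [map_smul, hs'])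
  choose z hz using hz
  have hu : ∀ n, ∃ u, I.cocomplex.d j (j + 1) u = r n • z (n + 1) - z n := fun n =>
    hex _ _ (by rw [map_sub, map_smul, hz, hz, smul_smul, ← hr, sub_self])
  choose v hv using hu
  choose q hq using fun n => (hB j).exists_smul_eq (hr0 n)
  -- Divisibility of the injective module in degree `j` solves `r n • c (n + 1) = c n + v n` from
  -- the initial value `0`, and `z n - d (c n)` is then strictly compatible.
  let c : ℕ → I.cocomplex.X j := fun n => Nat.rec 0 (fun n c => q n (c + v n)) n
  have hc : ∀ n, r n • c (n + 1) = c n + v n := fun n => hq n _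
  obtain ⟨t, ht⟩ := h.exists_forall_smul_eq (hB (j + 1)) hr
    (z := fun n => z n - I.cocomplex.d j (j + 1) (c n)) fun n => by
      rw [smul_sub, ← map_smul, hc, map_add, hv]
      abel
  refine ⟨⟨y - I.cocomplex.d (j + 1) (j + 2) t, h.mem_powerTorsion_iff.2 fun n => ?_⟩,
    Subtype.ext ?_⟩
  · rw [smul_sub, ← map_smul, ht, map_sub, hz, hdd, sub_zero, sub_self]
  · change I.cocomplex.d (j + 2) (j + 3) (y - I.cocomplex.d (j + 1) (j + 2) t) = _
    rw [map_sub, hdd, sub_zero]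

end Torsion

end IsLadder

/-! ### Injective abelian sheaves are flasque -/

/-- Sections over `U` are morphisms from the sheafified free abelian presheaf on `U`. A monomorphism
`U ⟶ V` induces a monomorphism of these sheaves, along which maps to an injective sheaf extend. -/
theorem CategoryTheory.Sheaf.map_surjective_of_injective {C : Type w} [Category.{u} C]
    {J : GrothendieckTopology C} [HasSheafify J AddCommGrpCat.{u}]
    (F : Sheaf J AddCommGrpCat.{u}) [Injective F] {U V : C} (i : U ⟶ V) [Mono i] :
    Function.Surjective (F.obj.map i.op) := by
  let P : C → (Cᵒᵖ ⥤ AddCommGrpCat.{u}) := fun W => yoneda.obj W ⋙ AddCommGrpCat.free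
  let j : P U ⟶ P V := Functor.whiskerRight (yoneda.map i) _
  have hj : Mono j := inferInstance
  let adj := sheafificationAdjunction J AddCommGrpCat.{u}
  have hj' : Mono ((presheafToSheaf J AddCommGrpCat.{u}).map j) := inferInstance
  intro s
  let φ : P U ⟶ F.obj :=
    { app := fun W => AddCommGrpCat.ofHom (FreeAbelianGroup.lift fun k : W.unop ⟶ U =>
        F.obj.map k.op s)
      naturality := fun W W' k => by
        refine AddCommGrpCat.hom_ext (FreeAbelianGroup.lift_ext _ _ fun l => ?_)
        change FreeAbelianGroup.lift (fun k : W'.unop ⟶ U => F.obj.map k.op s)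
          (FreeAbelianGroup.map (fun g : W.unop ⟶ U => k.unop ≫ g) (FreeAbelianGroup.of l)) =
          F.obj.map k (FreeAbelianGroup.lift (fun k : W.unop ⟶ U => F.obj.map k.op s)
            (FreeAbelianGroup.of l))
        rw [FreeAbelianGroup.map_of_apply, FreeAbelianGroup.lift_apply_of,
          FreeAbelianGroup.lift_apply_of, op_comp, F.obj.map_comp]
        rfl }
  let ψ := Injective.factorThru ((adj.homEquiv _ _).symm φ)
    ((presheafToSheaf J AddCommGrpCat.{u}).map j)
  have h1 : j ≫ adj.homEquiv _ _ ψ = φ := by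
    rw [← adj.homEquiv_naturality_left, Injective.comp_factorThru, Equiv.apply_symm_apply]
  let χ : P V ⟶ F.obj := adj.homEquiv _ _ ψ
  -- As in the Yoneda lemma, the extended section is the value at the generator given by the
  -- identity of `V`.
  refine ⟨χ.app (.op V) (FreeAbelianGroup.of (𝟙 V)), ?_⟩
  have h2 : χ.app (.op U) (FreeAbelianGroup.map (fun g : V ⟶ V => i ≫ g)
      (FreeAbelianGroup.of (𝟙 V))) = F.obj.map i.op (χ.app (.op V) (FreeAbelianGroup.of (𝟙 V))) :=
    ConcreteCategory.congr_hom (χ.naturality i.op) (FreeAbelianGroup.of (𝟙 V))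
  have h3 : χ.app (.op U) (FreeAbelianGroup.map (fun g : U ⟶ U => g ≫ i)
      (FreeAbelianGroup.of (𝟙 U))) =
      FreeAbelianGroup.lift (fun k : U ⟶ U => F.obj.map k.op s) (FreeAbelianGroup.of (𝟙 U)) :=
    ConcreteCategory.congr_hom (NatTrans.congr_app h1 (.op U)) (FreeAbelianGroup.of (𝟙 U))
  rw [FreeAbelianGroup.map_of_apply, Category.comp_id] at h2
  rw [FreeAbelianGroup.map_of_apply, Category.id_comp, FreeAbelianGroup.lift_apply_of, h2, op_id,
    F.obj.map_id] at h3
  exact h3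

namespace TopCat.Sheaf

variable {X : TopCat.{u}}

theorem isFlasque_of_injective (F : TopCat.Sheaf AddCommGrpCat.{u} X) [hF : Injective F] :
    IsFlasque F where
  epi i := (AddCommGrpCat.epi_iff_surjective _).2
    (@CategoryTheory.Sheaf.map_surjective_of_injective _ _ _ _ F hF _ _ i.unop _)

end TopCat.Sheaf

/-! ### Classes in local cohomology defined by an increasing union of open sets -/

namespace TopCat.Sheaf

variable {X : TopCat.{u}} {F G H : TopCat.Sheaf AddCommGrpCat.{u} X} {U V W : Opens X}

/-- The sections of an abelian sheaf over an open set. -/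
abbrev Sections (F : TopCat.Sheaf AddCommGrpCat.{u} X) (U : Opens X) : Type u :=
  F.obj.obj (.op U)

/-- The additive map induced on sections by a morphism of abelian sheaves. -/
def sectionsMap (f : F ⟶ G) (U : Opens X) : F.Sections U →+ G.Sections U :=
  (f.hom.app (.op U)).hom

/-- The restriction of sections of an abelian sheaf, as an additive map. -/
def res (F : TopCat.Sheaf AddCommGrpCat.{u} X) (h : U ≤ V) : F.Sections V →+ F.Sections U :=
  (F.obj.map (homOfLE h).op).hom

theorem sectionsMap_comp (f : F ⟶ G) (g : G ⟶ H) (s : F.Sections U) :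
    sectionsMap g U (sectionsMap f U s) = sectionsMap (f ≫ g) U s := rfl

theorem sectionsMap_zero (s : F.Sections U) : sectionsMap (0 : F ⟶ G) U s = 0 := rfl

theorem sectionsMap_res (f : F ⟶ G) (h : U ≤ V) (s : F.Sections V) :
    sectionsMap f U (F.res h s) = G.res h (sectionsMap f V s) :=
  ConcreteCategory.congr_hom (f.hom.naturality (homOfLE h).op) s

theorem res_res (h : U ≤ V) (h' : V ≤ W) (s : F.Sections W) :
    F.res h (F.res h' s) = F.res (h.trans h') s :=
  (ConcreteCategory.congr_hom (F.obj.map_comp (homOfLE h').op (homOfLE h).op) s).symm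

theorem res_self (h : U ≤ U) (s : F.Sections U) : F.res h s = s :=
  ConcreteCategory.congr_hom (F.obj.map_id (.op U)) s

theorem res_surjective [hF : IsFlasque F] (h : U ≤ V) : Function.Surjective (F.res h) :=
  (AddCommGrpCat.epi_iff_surjective _).1 (hF.epi (homOfLE h).op)

theorem sectionsMap_injective (f : F ⟶ G) [hf : Mono f] (U : Opens X) :
    Function.Injective (sectionsMap f U) := by
  have h1 : Mono ((Sheaf.forget AddCommGrpCat.{u} X).map f) := inferInstance
  exact (AddCommGrpCat.mono_iff_injective _).1
    ((NatTrans.mono_iff_mono_app ((Sheaf.forget AddCommGrpCat.{u} X).map f)).1 h1 (.op U))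

theorem eq_zero_of_forall_res_eq_zero {ι : Type*} {U : ι → Opens X} (s : F.Sections (iSup U))
    (h : ∀ i, F.res (le_iSup U i) s = 0) : s = 0 :=
  F.eq_of_locally_eq U s 0 fun i => (h i).trans (map_zero (F.res (le_iSup U i))).symm

theorem exists_glue {U : ℕ → Opens X} (hU : ∀ n, U n ≤ U (n + 1)) (s : ∀ n, F.Sections (U n))
    (hs : ∀ n, F.res (hU n) (s (n + 1)) = s n) :
    ∃ t : F.Sections (iSup U), ∀ n, F.res (le_iSup U n) t = s n := by
  have hmono : Monotone U := monotone_nat_of_le_succ hU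
  have hle : ∀ {m n : ℕ} (hmn : m ≤ n), F.res (hmono hmn) (s n) = s m := by
    intro m n hmn
    induction n, hmn using Nat.le_induction with
    | base => exact res_self _ _
    | succ n hmn ih => rw [← ih, ← hs n, res_res]
  have hc : ∀ m n, F.res inf_le_left (s m) = F.res (inf_le_right : U m ⊓ U n ≤ U n) (s n) := by
    intro m n
    rcases le_total m n with hmn | hmn
    · rw [← hle hmn, res_res]
    · rw [← hle hmn, res_res]
  obtain ⟨t, ht, -⟩ := F.existsUnique_gluing U s hc
  exact ⟨t, ht⟩

theorem sections_exact {S : ShortComplex (TopCat.Sheaf AddCommGrpCat.{u} X)}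
    (hS : S.Exact) (hf : Mono S.f) (s : S.X₂.Sections U) (hs : sectionsMap S.g U s = 0) :
    ∃ t, sectionsMap S.f U t = s :=
  Sheaf.sections_exact_of_left_exact hS hf s hs

/-- If the only neighbourhood of a point is the whole space, an exact sequence of abelian sheaves
is exact on global sections. -/
theorem global_sections_exact {S : ShortComplex (TopCat.Sheaf AddCommGrpCat.{u} X)}
    (hS : S.Exact) {p : X} (hp : ∀ U : Opens X, p ∈ U → U = ⊤) (s : S.X₂.Sections ⊤)
    (hs : sectionsMap S.g ⊤ s = 0) : ∃ t, sectionsMap S.f ⊤ t = s := by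
  have hepi : Epi S.toCycles := hS.epi_toCycles
  obtain ⟨t, ht⟩ := sections_exact
    (S := ShortComplex.mk S.iCycles S.g S.iCycles_g)
    (ShortComplex.exact_of_f_is_kernel _ S.cyclesIsKernel)
    (inferInstanceAs (Mono S.iCycles)) s hs
  -- Surjectivity onto the sheaf of cycles is only local, but a lift near `p` is already global.
  obtain ⟨V, hV, ⟨z, hz⟩, hpV⟩ := (Presheaf.isLocallySurjective_iff _).1
    ((isLocallySurjective_iff_epi S.toCycles).2 hepi) ⊤ t p (Opens.mem_top p)
  obtain rfl := hp V hpV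
  have hz' : sectionsMap S.toCycles ⊤ z = t := Eq.trans hz (res_self le_rfl t)
  refine ⟨z, ?_⟩
  rw [← S.toCycles_i, ← sectionsMap_comp, hz']
  exact ht

/-- The inclusion of the sections with support in `Z` into the global sections. -/
noncomputable def supportInclusion (F : TopCat.Sheaf AddCommGrpCat.{u} X) (Z : Closeds X) :
    (sectionsWithSupport Z).obj F →+ F.Sections ⊤ :=
  (kernel.ι (F.presheaf.map (homOfLE (le_top : Z.compl ≤ ⊤)).op)).hom

theorem supportInclusion_injective (F : TopCat.Sheaf AddCommGrpCat.{u} X) (Z : Closeds X) :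
    Function.Injective (F.supportInclusion Z) :=
  (AddCommGrpCat.mono_iff_injective _).1
    (inferInstanceAs (Mono (kernel.ι (F.presheaf.map (homOfLE (le_top : Z.compl ≤ ⊤)).op))))

theorem res_supportInclusion (Z : Closeds X) (t : (sectionsWithSupport Z).obj F) :
    F.res (le_top : Z.compl ≤ ⊤) (F.supportInclusion Z t) = 0 :=
  ConcreteCategory.congr_hom
    (kernel.condition (F.presheaf.map (homOfLE (le_top : Z.compl ≤ ⊤)).op)) t

theorem supportInclusion_map (f : F ⟶ G) (Z : Closeds X) (t : (sectionsWithSupport Z).obj F) :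
    G.supportInclusion Z ((sectionsWithSupport Z).map f t) =
      sectionsMap f ⊤ (F.supportInclusion Z t) :=
  ConcreteCategory.congr_hom (kernel.lift_ι (G.presheaf.map _) _ _) t

theorem exists_supportInclusion_eq (Z : Closeds X) (s : F.Sections ⊤)
    (hs : F.res (le_top : Z.compl ≤ ⊤) s = 0) : ∃ t, F.supportInclusion Z t = s :=
  (ShortComplex.ab_exact_iff (ShortComplex.mk _ _ (kernel.condition (F.presheaf.map
      (homOfLE (le_top : Z.compl ≤ ⊤)).op)))).1
    (ShortComplex.exact_of_f_is_kernel _ (kernelIsKernel _)) s hs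

/-- This is the vanishing of `lim¹ F(U n)`. That group embeds in `H¹(X ∖ Z, F)`, which is `H²_Z(F)`
here because global sections are exact. The proof makes these maps explicit in an injective
resolution. -/
theorem exists_res_eq_add_of_isZero {Z : Closeds X} {p : X} (hp : ∀ U : Opens X, p ∈ U → U = ⊤)
    {U : ℕ → Opens X} (hU : ∀ n, U n ≤ U (n + 1)) (hZ : iSup U = Z.compl)
    (h : IsZero ((localCohomologyWithSupport Z 2).obj F)) (a : ∀ n, F.Sections (U n)) :
    ∃ b : ∀ n, F.Sections (U n), ∀ n, F.res (hU n) (b (n + 1)) = b n + a n := by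
  let I := InjectiveResolution.of F
  let G : ℕ → TopCat.Sheaf AddCommGrpCat.{u} X := I.cocomplex.X
  have hG : ∀ n, IsFlasque (G n) := fun n =>
    @isFlasque_of_injective X (G n) (I.injective n)
  let d : ∀ n, G n ⟶ G (n + 1) := fun n => I.cocomplex.d n (n + 1)
  have hdd : ∀ n, d n ≫ d (n + 1) = 0 := fun n => I.cocomplex.d_comp_d _ _ _
  let ι : F ⟶ G 0 := I.ι.f 0
  have hι : ι ≫ d 0 = 0 := I.ι_f_zero_comp_complex_d
  have h0 : (ShortComplex.mk ι (d 0) hι).Exact := I.exact₀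
  have h1 : (ShortComplex.mk (d 0) (d 1) (hdd 0)).Exact :=
    (I.cocomplex.exactAt_iff' 0 1 2 (by simp) (by simp)).1 (I.cocomplex_exactAt_succ 0)
  have hmono : Mono ι := inferInstanceAs (Mono (I.ι.f 0))
  have h2 : (ShortComplex.mk ((sectionsWithSupport Z).map (d 1)) ((sectionsWithSupport Z).map (d 2))
      (by rw [← Functor.map_comp, hdd, Functor.map_zero])).Exact :=
    (HomologicalComplex.exactAt_iff' _ 1 2 3 (by simp) (by simp)).1
      ((HomologicalComplex.exactAt_iff_isZero_homology _ _).2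
        (h.of_iso (I.isoRightDerivedObj (sectionsWithSupport Z) 2).symm))
  have hsupp : ∀ s : (G 2).Sections ⊤, (G 2).res (le_top : Z.compl ≤ ⊤) s = 0 →
      sectionsMap (d 2) ⊤ s = 0 → ∃ z : (G 1).Sections ⊤,
        (G 1).res (le_top : Z.compl ≤ ⊤) z = 0 ∧ sectionsMap (d 1) ⊤ z = s := by
    intro s hs hds
    obtain ⟨s, rfl⟩ := exists_supportInclusion_eq Z s hs
    obtain ⟨z, rfl⟩ := (ShortComplex.ab_exact_iff _).1 h2 s
      (supportInclusion_injective (G 3) Z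
        (((supportInclusion_map (d 2) Z s).trans hds).trans (map_zero _).symm))
    exact ⟨_, res_supportInclusion Z z, (supportInclusion_map (d 1) Z z).symm⟩
  rw [← hZ] at hsupp
  -- In the flasque sheaf `G 0` the difference equation can be solved by successive extension.
  have hext : ∀ n (s : (G 0).Sections (U n)), ∃ t : (G 0).Sections (U (n + 1)),
      (G 0).res (hU n) t = s + sectionsMap ι _ (a n) := fun n s => res_surjective _ _
  choose ext hext using hext
  let t : ∀ n, (G 0).Sections (U n) := fun n => Nat.rec 0 (fun n s => ext n s) n
  have ht : ∀ n, (G 0).res (hU n) (t (n + 1)) = t n + sectionsMap ι _ (a n) := fun n => hext n _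
  -- The sections `t n` disagree by elements of `F`, which `d 0` kills, so their differentials glue.
  obtain ⟨g, hg⟩ := exists_glue (F := G 1) hU (fun n => sectionsMap (d 0) _ (t n)) fun n => by
    rw [← sectionsMap_res, ht, map_add, sectionsMap_comp, hι, sectionsMap_zero, add_zero]
  obtain ⟨s, hs⟩ := res_surjective (F := G 1) (le_top : iSup U ≤ ⊤) g
  -- The differential of the extension `s` is a 2-cocycle supported in `Z`. The hypothesis on `H²`
  -- allows `s` to be changed by a section supported in `Z` into a global cocycle, which still
  -- restricts to `g`.
  obtain ⟨z, hz, hdz⟩ := hsupp (sectionsMap (d 1) _ s)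
    (eq_zero_of_forall_res_eq_zero _ fun n => by
      rw [← sectionsMap_res, hs, ← sectionsMap_res, hg, sectionsMap_comp, hdd, sectionsMap_zero])
    (by rw [sectionsMap_comp, hdd, sectionsMap_zero])
  obtain ⟨y, hy⟩ := global_sections_exact h1 hp (s - z) (by
    rw [map_sub]
    exact sub_eq_zero.2 hdz.symm)
  -- Subtracting one global primitive `y` turns every `t n` into a 0-cocycle, that is, a section of
  -- `F`, without affecting the difference equation.
  have hb : ∀ n, ∃ b, sectionsMap ι (U n) b = t n - (G 0).res le_top y := fun n =>
    sections_exact h0 hmono _ (by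
      have h3 : sectionsMap (d 0) ⊤ y = s - z := hy
      have h4 : (G 1).res (le_top : U n ≤ ⊤) (s - z) = sectionsMap (d 0) _ (t n) := by
        rw [← res_res (le_iSup U n) le_top, map_sub, hs, hz, sub_zero, hg]
      change sectionsMap (d 0) _ _ = 0
      rw [map_sub, sectionsMap_res, h3, h4, sub_self])
  choose b hb using hb
  refine ⟨b, fun n => sectionsMap_injective ι _ ?_⟩
  rw [sectionsMap_res, hb, map_sub, ht, res_res, map_add, hb]
  abel

end TopCat.Sheaf

/-! ### Sections of the structure sheaf over basic open sets as fractions -/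

section Fractions

variable {R : CommRingCat.{u}} (K : Type*) [Field K] [Algebra R K] [IsFractionRing R K]

/-- The basic open set defined by an element of a ring, as an open set of the affine scheme. -/
def specBasicOpen {R : CommRingCat.{u}} (f : R) : (Spec R).Opens := PrimeSpectrum.basicOpen f

instance isLocalization_specBasicOpen {R : CommRingCat.{u}} (f : R) :
    IsLocalization.Away f Γ(Spec R, specBasicOpen f) :=
  IsAffineOpen.instAwayCarrierObjOppositeOpensCarrierCarrierCommRingCatSpecPresheafOpOpensBasicOpen

/-- A section of the structure sheaf over a basic open set of the spectrum of a domain, as an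
element of the field of fractions. -/
noncomputable def sectionToFraction (f : R) (hf : f ≠ 0) :
    Γ(Spec R, specBasicOpen f) →+* K :=
  IsLocalization.Away.lift (S := Γ(Spec R, specBasicOpen f)) (g := algebraMap R K) f
    (IsUnit.mk0 _ ((map_ne_zero_iff _ (IsFractionRing.injective R K)).2 hf))

theorem sectionToFraction_algebraMap (f : R) (hf : f ≠ 0) (a : R) :
    sectionToFraction K f hf (algebraMap R _ a) = algebraMap R K a :=
  IsLocalization.Away.lift_eq _ _ _

/-- Restriction between basic open sets becomes equality in `K`, so relations between sections over
different open sets can be read in one field. -/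
theorem sectionToFraction_map {f g : R} (hf : f ≠ 0) (hg : g ≠ 0)
    (h : specBasicOpen f ≤ specBasicOpen g)
    (s : Γ(Spec R, specBasicOpen g)) :
    sectionToFraction K f hf ((Spec R).presheaf.map (homOfLE h).op s) =
      sectionToFraction K g hg s := by
  have key : (sectionToFraction K f hf).comp ((Spec R).presheaf.map (homOfLE h).op).hom =
      sectionToFraction K g hg := by
    refine IsLocalization.ringHom_ext (Submonoid.powers g) (RingHom.ext fun a => ?_)
    refine Eq.trans ?_ (sectionToFraction_algebraMap K g hg a).symm
    exact sectionToFraction_algebraMap K f hf a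
  exact RingHom.congr_fun key s

theorem exists_pow_mul_sectionToFraction (f : R) (hf : f ≠ 0)
    (s : Γ(Spec R, specBasicOpen f)) :
    ∃ (k : ℕ) (a : R), algebraMap R K f ^ k * sectionToFraction K f hf s = algebraMap R K a := by
  obtain ⟨k, a, h⟩ := IsLocalization.Away.surj f s
  refine ⟨k, a, ?_⟩
  rw [← sectionToFraction_algebraMap K f hf a, ← h, map_mul, map_pow,
    sectionToFraction_algebraMap, mul_comm]

theorem exists_sectionToFraction_eq_inv (f : R) (hf : f ≠ 0) :
    ∃ s, sectionToFraction K f hf s = (algebraMap R K f)⁻¹ := by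
  refine ⟨IsLocalization.Away.invSelf f, eq_inv_of_mul_eq_one_right ?_⟩
  rw [← sectionToFraction_algebraMap K f hf f, ← map_mul, IsLocalization.Away.mul_invSelf, map_one]

end Fractions

/-! ### The punctured spectrum -/

namespace IsLadder

section

variable {A : Type u} [CommRing A] [IsLocalRing A] {x : ℕ → A}

theorem iSup_basicOpen (h : IsLadder x) :
    (⨆ n, PrimeSpectrum.basicOpen (x n) : Opens (Spec (CommRingCat.of A))) =
      (closedPointSet A).compl := by
  ext p
  refine Iff.trans Opens.mem_iSup ?_
  change (∃ n, x n ∉ PrimeSpectrum.asIdeal p) ↔ ¬ p = IsLocalRing.closedPoint A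
  rw [← not_forall, not_iff_not]
  constructor
  · intro hp
    refine PrimeSpectrum.ext (le_antisymm (IsLocalRing.le_maximalIdeal p.isPrime.ne_top) ?_)
    change IsLocalRing.maximalIdeal A ≤ _
    rw [h.span_eq, Ideal.span_le]
    rintro _ ⟨n, rfl⟩
    exact hp n
  · rintro rfl n
    exact h.mem n

theorem basicOpen_le (h : IsLadder x) (n : ℕ) :
    PrimeSpectrum.basicOpen (x n) ≤ PrimeSpectrum.basicOpen (x (n + 1)) :=
  fun p hp hn => hp (Ideal.mem_of_dvd (PrimeSpectrum.asIdeal p) (h.dvd_of_le n.le_succ) hn)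

end

variable {A : Type u} [CommRing A] [IsDomain A] [ValuationRing A] {x : ℕ → A}

/-- Compactness would make a single `D(x n)` the whole punctured spectrum, but the prime of index `n
+ 1` contains `x n` and not `x (n + 1)`. -/
theorem not_isCompact_compl_closedPoint (h : IsLadder x) :
    ¬ IsCompact ((closedPointSet A).compl : Set (Spec (CommRingCat.of A))) := by
  intro hc
  rw [← h.iSup_basicOpen] at hc
  obtain ⟨n, hn⟩ := hc.elim_directed_cover
    (fun n => (PrimeSpectrum.basicOpen (x n) : Set (PrimeSpectrum A)))
    (fun n => (PrimeSpectrum.basicOpen (x n)).2) (Opens.coe_iSup _).le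
    (directed_of_isDirected_le fun m n hmn =>
      (monotone_nat_of_le_succ h.basicOpen_le hmn : PrimeSpectrum.basicOpen (x m) ≤ _))
  have h1 : x (n + 1) ∉ (h.prime (n + 1)).asIdeal := fun hm =>
    lt_irrefl _ (h.mem_prime_iff_lt.1 hm)
  exact hn (Opens.mem_iSup.2 ⟨n + 1, h1⟩) (h.mem_prime_iff_lt.2 n.lt_succ_self)

end IsLadder

/-! ### Second local cohomology of the structure sheaf, and the conclusion -/

theorem not_isZero_localCohomologyWithSupport :
    ¬ IsZero ((localCohomologyWithSupport (closedPointSet lexRing) 2).obj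
      (abStructureSheaf (Spec (CommRingCat.of lexRing)))) := by
  intro h
  let R := CommRingCat.of lexRing
  let x : ℕ → R := lexVar
  have hx : ∀ n, x n ≠ 0 := lexVar_ne_zero
  let ev n := sectionToFraction (R := R) RatField (x n) (hx n)
  choose a ha using fun n => exists_sectionToFraction_eq_inv (R := R) RatField (x n) (hx n)
  obtain ⟨b, hb⟩ := TopCat.Sheaf.exists_res_eq_add_of_isZero
    (p := IsLocalRing.closedPoint lexRing)
    (fun U hU => (IsLocalRing.closedPoint_mem_iff U).1 hU) isLadder_lexVar.basicOpen_le
    isLadder_lexVar.iSup_basicOpen h a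
  -- Read in the field of fractions, the difference equation with `a n = 1 / x n` telescopes, so `b
  -- 0` would play the role of minus the sum of the series of inverses. Some power of `x n` clears
  -- the denominator of `b n`, contradicting `exists_forall_pow_mul_notMem`.
  have hev : ∀ n, ev n (b n) = ev 0 (b 0) + ∑ i ∈ Finset.range n, (ratVar i)⁻¹ := by
    intro n
    induction n with
    | zero => simp
    | succ n ih =>
      rw [Finset.sum_range_succ, ← add_assoc, ← ih]
      refine (sectionToFraction_map (R := R) RatField (hx n) (hx (n + 1))
        (isLadder_lexVar.basicOpen_le n) (b (n + 1))).symm.trans ?_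
      refine (congrArg (ev n) (hb n)).trans ((map_add (ev n) (b n) (a n)).trans ?_)
      exact congrArg _ (ha n)
  obtain ⟨n, hn⟩ := exists_forall_pow_mul_notMem (ev 0 (b 0))
  obtain ⟨k, c, hc⟩ := exists_pow_mul_sectionToFraction (R := R) RatField (x n) (hx n) (b n)
  refine hn k ?_
  rw [← hev]
  exact (Eq.mpr (congrArg (· ∈ lexRing) hc) (SetLike.coe_mem (c : lexRing)) :)

theorem proposition7p1 :
    ringKrullDim lexRing = ⊤ ∧
    ¬ (IsLocalRing.maximalIdeal lexRing).FG ∧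
    IsLocalRing.maximalIdeal lexRing = Ideal.span (Set.range lexVar) ∧
    ¬ IsCompact ((closedPointSet lexRing).compl : Set (Spec (CommRingCat.of lexRing))) ∧
    ¬ IsAffineOpen (closedPointSet lexRing).compl ∧
    ¬ IsZero ((localCohomologyWithSupport (closedPointSet lexRing) 2).obj
      (abStructureSheaf (Spec (CommRingCat.of lexRing)))) ∧
    projectiveDimension (ModuleCat.of lexRing (IsLocalRing.ResidueField lexRing)) = 2 ∧
    ∀ (M : ModuleCat.{w} lexRing) (i : ℕ), 3 ≤ i →
      IsZero ((torsionCohomology.{0, w} (IsLocalRing.maximalIdeal lexRing) i).obj M) :=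
  ⟨isLadder_lexVar.ringKrullDim_eq_top, isLadder_lexVar.not_fg, isLadder_lexVar.span_eq,
    isLadder_lexVar.not_isCompact_compl_closedPoint,
    fun h => isLadder_lexVar.not_isCompact_compl_closedPoint h.isCompact,
    not_isZero_localCohomologyWithSupport,
    isLadder_lexVar.projectiveDimension_residueField,
    fun M _ hi => isLadder_lexVar.isZero_torsionCohomology M hi⟩
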